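/- Theorem 2. Let $\frac12<p<1$ and let $f:\{1,2,3,\dots\}\to[0,\infty)$ be monotonically increasing (that is, $f(i)\le f(j)$ whenever $i\le j$). Consider the following frog model on $\mathbb{Z}$ in discrete time. At time $0$ there is one active frog at the origin, and at each site $j\ge 1$ there are $\eta_j$ sleeping frogs, where the $\eta_j$ are independent Poisson random variables with $\mathbf{E}[\eta_j]=f(j)$; there are no other frogs. At each time step every active frog moves one unit to the left with probability $p$ and one unit to the right with probability $1-p$, all steps of all frogs being independent of each other and of the $\eta_j$. Whenever an active frog lands on a site that contains sleeping frogs, these frogs wake up, and from then on they are active and perform such random walks themselves. The model is called transient if the probability that the origin is hit by infinitely many different frogs is $0$. Then the model is transient if and only if $$\sum_{j=1}^{\infty}e^{-\frac{1-p}{2p-1}f(j)}=\infty .$$ -/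

import Mathlib

open MeasureTheory ProbabilityTheory
open scoped ENNReal NNReal

noncomputable section

namespace FrogModel

/-- Labels of (potential) frogs: `none` is the frog that starts active at the origin, and
`some (j, k)` is the `k`-th frog (`k = 0, 1, 2, …`) of the site `j ≥ 1`. The frog `some (j, k)` is
really there only if `k` is less than the number of frogs sleeping at `j`. -/
abbrev Frog : Type := Option (ℕ+ × ℕ)

/-- Sample space: the number of frogs sleeping at each site `j ≥ 1`, and for every frog label the
sequence of increments of the walk which that frog performs once it is active. -/
abbrev Sample : Type := (ℕ+ → ℕ) × (Frog → ℕ → ℤ)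

/-- The law of the model: the numbers of sleeping frogs are independent, Poisson with mean `f j`
at `j`, and, independently of them, all increments of all walks are independent, equal to `-1` with
probability `p` and to `1` with probability `1 - p`. -/
def law (p : unitInterval) (f : ℕ+ → ℝ≥0) : Measure Sample :=
  (Measure.infinitePi fun j => poissonMeasure (f j)).prod
    (Measure.infinitePi fun _ : Frog =>
      Measure.infinitePi fun _ : ℕ => bernoulliMeasure (-1 : ℤ) 1 p)

instance (p : unitInterval) (f : ℕ+ → ℝ≥0) : IsProbabilityMeasure (law p f) := by
  unfold law
  infer_instance

/-- The initial position of a frog. -/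
def start : Frog → ℤ
  | none => 0
  | some (j, _) => (j : ℕ)

/-- Whether a frog label is occupied by a frog. -/
def Present (ω : Sample) : Frog → Prop
  | none => True
  | some (j, k) => k < ω.1 j

/-- The position of frog `i` after the first `a` steps of its walk. -/
def position (ω : Sample) (i : Frog) (a : ℕ) : ℤ :=
  start i + ∑ m ∈ Finset.range a, ω.2 i m

open scoped Classical in
/-- The evolution in time. `state ω n i = none` means that at time `n` frog `i` is asleep (or not
present), and `state ω n i = some a` that it is active and has made `a` steps since it woke up.
At each time step every active frog makes one step, and every sleeping frog on whose site one of
them lands wakes up; it makes its own first step at the next time step. -/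
def state (ω : Sample) : ℕ → Frog → Option ℕ
  | 0, i => if i = none then some 0 else none
  | n + 1, i =>
    match state ω n i with
    | some a => some (a + 1)
    | none =>
      if Present ω i ∧ ∃ i' a, state ω n i' = some a ∧ position ω i' (a + 1) = start i
      then some 0 else none

/-- Frog `i` is at the origin at some time at which it is active. -/
def HitsOrigin (ω : Sample) (i : Frog) : Prop :=
  ∃ n a, state ω n i = some a ∧ position ω i a = 0

/-- The model is transient if the probability that the origin is hit by infinitely many different
frogs is `0`. -/
def Transient (p : unitInterval) (f : ℕ+ → ℝ≥0) : Prop :=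
  law p f {ω | {i | HitsOrigin ω i}.Infinite} = 0

end FrogModel

end

/-!
Every walk drifts to the left, so almost surely every frog that wakes up visits the origin, and the
question is whether infinitely many frogs wake up. Let a site `m ≥ 1` be *missed* if no frog
starting to the left of `m` has a walk that visits `m` (`allMiss 0 m`). Since walks make
nearest-neighbour steps, a missed site stops the spread (`finite_hitsOrigin`); if no site is
missed, all frogs wake up (`activated_of_forall_notMem_allMiss`), and there are infinitely many of
them, because each walk visits only finitely many sites on the right (`infinite_hitsOrigin`).

A walk visits the site at distance `d` to its right with probability `r ^ d`, where
`r = (1 - p) / p` (`hitProb_natCast`). By Poisson thinning the frogs of the sites `1, …, m - 1` miss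
`m` with probability `u m = exp (-∑ f k * r ^ (m - k))` (`law_real_allMiss`), written `gapProb`.
The sum over all powers `r ^ i`, `i ≥ 1`, is `α = (1 - p) / (2 p - 1)`, and `∑ u m` converges if and
only if `∑ exp (-α * f j)` does: monotonicity of `f` gives `u (m + 1) ≥ exp (-α * f m)`
(`meanVisits_le`), and convexity of `exp` gives
`u (m + 1) ≤ r * u m + (1 - r) * exp (-α * f m)` (`gapProb_succ_le`).

If `∑ u m = ∞`, decompose according to the first missed site `n`. The frogs that start before `n`
do not pass `n`, hence for `m ≥ n` only those of the sites `n, …, m - 1` matter; these are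
independent of the past, and by monotonicity they miss `m` with probability at most `u (m - n + 1)`
(`law_real_allMiss_le`). Summing over `m ≤ N`, the expected number of missed sites is at most
`P(some site is missed) * ∑ u m`. As it differs from `∑ u m` by a bounded amount, that
probability is `1` (`law_real_iUnion_allMiss`).

If `∑ u m < ∞`, choose `N` with `∑_{m > N} u m < 1`. With positive probability the walk of the frog
at the origin visits `N`, and independently of this the other frogs miss no site beyond `N`; then
no site is missed (`not_transient_of_summable`).
-/

namespace FrogModel

/-! ### Hitting probabilities of a single walk -/

/-- The law of the increments of a single frog. -/
noncomputable abbrev stepsLaw (p : unitInterval) : Measure (ℕ → ℤ) :=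
  Measure.infinitePi fun _ : ℕ => bernoulliMeasure (-1 : ℤ) 1 p

/-- The increment sequences whose partial sums visit `d` (at time `0` or later). -/
def visits (d : ℤ) : Set (ℕ → ℤ) := {x | ∃ a, ∑ m ∈ Finset.range a, x m = d}

/-- The increment sequences whose partial sums visit `d` at some time `≤ N`. -/
def visitsBy (N : ℕ) (d : ℤ) : Set (ℕ → ℤ) := {x | ∃ a ≤ N, ∑ m ∈ Finset.range a, x m = d}

lemma measurableSet_visits (d : ℤ) : MeasurableSet (visits d) := by
  have : visits d = ⋃ a, (fun x : ℕ → ℤ => ∑ m ∈ Finset.range a, x m) ⁻¹' {d} := by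
    ext; simp [visits]
  rw [this]
  refine MeasurableSet.iUnion fun a => ?_
  exact (Finset.measurable_sum _ fun i _ => measurable_pi_apply i) (measurableSet_singleton d)

lemma measurableSet_visitsBy (N : ℕ) (d : ℤ) : MeasurableSet (visitsBy N d) := by
  have : visitsBy N d =
      ⋃ a ∈ Set.Iic N, (fun x : ℕ → ℤ => ∑ m ∈ Finset.range a, x m) ⁻¹' {d} := by
    ext; simp [visitsBy]
  rw [this]
  refine MeasurableSet.biUnion (Set.to_countable _) fun a _ => ?_
  exact (Finset.measurable_sum _ fun i _ => measurable_pi_apply i) (measurableSet_singleton d)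

lemma measurable_shift : Measurable fun (x : ℕ → ℤ) m => x (m + 1) :=
  measurable_pi_iff.2 fun m => measurable_pi_apply (m + 1)

/-- The first increment is independent of the later ones, whose joint law is that of the whole
sequence. -/
lemma stepsLaw_first_step (p : unitInterval) (c : ℤ) {S : Set (ℕ → ℤ)} (hS : MeasurableSet S) :
    (stepsLaw p).real ({x | x 0 = c} ∩ {x | (fun m => x (m + 1)) ∈ S}) =
      (bernoulliMeasure (-1 : ℤ) 1 p).real {c} * (stepsLaw p).real S := by
  have hind : iIndep (fun i : ℕ => MeasurableSpace.comap (fun x : ℕ → ℤ => x i) inferInstance)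
      (stepsLaw p) :=
    iIndepFun_infinitePi (P := fun _ : ℕ => bernoulliMeasure (-1 : ℤ) 1 p)
      (X := fun _ x => x) (fun _ => measurable_id)
  have h2 := indep_iSup_of_disjoint (fun i => (measurable_pi_apply i).comap_le) hind
    (S := {0}) (T := {0}ᶜ) disjoint_compl_right
  have h3 := Indep_iff _ _ _ |>.1 h2 {x : ℕ → ℤ | x 0 = c}
    {x : ℕ → ℤ | (fun m => x (m + 1)) ∈ S} ?_ ?_
  · rw [measureReal_def, h3, ENNReal.toReal_mul, ← measureReal_def, ← measureReal_def]
    congr 1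
    · conv_rhs => rw [← Measure.infinitePi_map_eval
        (fun _ : ℕ => bernoulliMeasure (-1 : ℤ) 1 p) 0]
      rw [map_measureReal_apply (measurable_pi_apply 0) (measurableSet_singleton c)]
      rfl
    · have := Measure.map_infinitePi_infinitePi_of_inj
        (P := fun _ : ℕ => bernoulliMeasure (-1 : ℤ) 1 p) (f := fun m : ℕ => m + 1)
        (add_left_injective 1)
      conv_rhs => rw [stepsLaw, ← this]
      rw [map_measureReal_apply measurable_shift hS]
      rfl
  · refine le_iSup₂_of_le (f := fun i (_ : i ∈ ({0} : Set ℕ)) =>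
      MeasurableSpace.comap (fun x : ℕ → ℤ => x i) inferInstance) 0 rfl le_rfl _ ?_
    exact ⟨{c}, measurableSet_singleton c, rfl⟩
  · have hm : Measurable[⨆ i ∈ ({0}ᶜ : Set ℕ),
        MeasurableSpace.comap (fun x : ℕ → ℤ => x i) inferInstance]
        fun (x : ℕ → ℤ) m => x (m + 1) := by
      refine @measurable_pi_lambda _ _ _ (_) _ _ fun m => ?_
      refine Measurable.mono (comap_measurable fun x : ℕ → ℤ => x (m + 1)) ?_ le_rfl
      exact le_iSup₂_of_le (m + 1) (by simp) le_rfl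
    exact hm hS

lemma ae_step (p : unitInterval) :
    ∀ᵐ x ∂(stepsLaw p), ∀ m, x m = -1 ∨ x m = 1 := by
  refine ae_all_iff.2 fun m => ?_
  have h : ∀ᵐ y ∂(bernoulliMeasure (-1 : ℤ) 1 p), y = -1 ∨ y = 1 := by
    rw [ae_iff, bernoulliMeasure_apply_of_notMem_of_notMem] <;> simp
  rw [← Measure.infinitePi_map_eval (fun _ : ℕ => bernoulliMeasure (-1 : ℤ) 1 p) m] at h
  exact ae_of_ae_map (measurable_pi_apply m).aemeasurable h

/-- Decomposition of an event according to the first step. -/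
lemma stepsLaw_first_step_decomp (p : unitInterval) {A : Set (ℕ → ℤ)}
    {S T : Set (ℕ → ℤ)} (hS : MeasurableSet S) (hT : MeasurableSet T)
    (h1 : ∀ x : ℕ → ℤ, x 0 = -1 → (x ∈ A ↔ (fun m => x (m + 1)) ∈ S))
    (h2 : ∀ x : ℕ → ℤ, x 0 = 1 → (x ∈ A ↔ (fun m => x (m + 1)) ∈ T)) :
    (stepsLaw p).real A = p * (stepsLaw p).real S + (1 - p) * (stepsLaw p).real T := by
  have e1 := stepsLaw_first_step p (-1) hS
  have e2 := stepsLaw_first_step p 1 hT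
  rw [bernoulliMeasure_real_apply_of_mem_of_notMem _ (measurableSet_singleton _) (by simp)
    (by simp)] at e1
  rw [bernoulliMeasure_real_apply_of_notMem_of_mem _ (measurableSet_singleton _) (by simp)
    (by simp)] at e2
  have e3 : (stepsLaw p).real A = (stepsLaw p).real
      (({x | x 0 = -1} ∩ {x | (fun m => x (m + 1)) ∈ S}) ∪
        ({x | x 0 = 1} ∩ {x | (fun m => x (m + 1)) ∈ T})) := by
    refine measureReal_congr ?_
    filter_upwards [ae_step p] with x hx
    refine propext ?_
    change x ∈ A ↔ (x 0 = -1 ∧ _ ∈ S) ∨ (x 0 = 1 ∧ _ ∈ T)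
    rcases hx 0 with h | h
    · simp [h, h1 x h]
    · simp [h, h2 x h]
  rw [e3, measureReal_union, e1, e2]
  · refine Set.disjoint_left.2 fun x hx hx' => ?_
    have := hx.1.symm.trans hx'.1
    norm_num at this
  · exact (measurable_pi_apply 0 (measurableSet_singleton (1 : ℤ))).inter (measurable_shift hT)

lemma mem_visits_iff_shift {d : ℤ} (hd : d ≠ 0) (x : ℕ → ℤ) :
    x ∈ visits d ↔ (fun m => x (m + 1)) ∈ visits (d - x 0) := by
  constructor
  · rintro ⟨a, ha⟩
    cases a with
    | zero => simp at ha; exact absurd ha.symm hd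
    | succ a =>
      rw [Finset.sum_range_succ'] at ha
      exact ⟨a, by simp only; linarith⟩
  · rintro ⟨a, ha⟩
    refine ⟨a + 1, ?_⟩
    rw [Finset.sum_range_succ']
    simp only at ha
    linarith

lemma mem_visitsBy_iff_shift {N : ℕ} {d : ℤ} (hd : d ≠ 0) (x : ℕ → ℤ) :
    x ∈ visitsBy (N + 1) d ↔ (fun m => x (m + 1)) ∈ visitsBy N (d - x 0) := by
  constructor
  · rintro ⟨a, haN, ha⟩
    cases a with
    | zero => simp at ha; exact absurd ha.symm hd
    | succ a =>
      rw [Finset.sum_range_succ'] at ha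
      exact ⟨a, by omega, by simp only; linarith⟩
  · rintro ⟨a, haN, ha⟩
    refine ⟨a + 1, by omega, ?_⟩
    rw [Finset.sum_range_succ']
    simp only at ha
    linarith

/-- The probability that a walk visits `d`. -/
noncomputable def hitProb (p : unitInterval) (d : ℤ) : ℝ := (stepsLaw p).real (visits d)

lemma hitProb_zero (p : unitInterval) : hitProb p 0 = 1 := by
  have : visits 0 = Set.univ := Set.eq_univ_of_forall fun x => ⟨0, by simp⟩
  simp [hitProb, this]

lemma hitProb_rec (p : unitInterval) {d : ℤ} (hd : d ≠ 0) :
    hitProb p d = p * hitProb p (d + 1) + (1 - p) * hitProb p (d - 1) := by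
  refine stepsLaw_first_step_decomp p (measurableSet_visits _)
    (measurableSet_visits _) (fun x hx => ?_) fun x hx => ?_
  · rw [mem_visits_iff_shift hd, hx, sub_neg_eq_add]
  · rw [mem_visits_iff_shift hd, hx]

lemma visitsBy_rec (p : unitInterval) (N : ℕ) {d : ℤ} (hd : d ≠ 0) :
    (stepsLaw p).real (visitsBy (N + 1) d) = p * (stepsLaw p).real (visitsBy N (d + 1)) +
      (1 - p) * (stepsLaw p).real (visitsBy N (d - 1)) := by
  refine stepsLaw_first_step_decomp p (measurableSet_visitsBy _ _)
    (measurableSet_visitsBy _ _) (fun x hx => ?_) fun x hx => ?_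
  · rw [mem_visitsBy_iff_shift hd, hx, sub_neg_eq_add]
  · rw [mem_visitsBy_iff_shift hd, hx]

/-- The odds `(1 - p) / p` of a step to the right. -/
noncomputable def odds (p : unitInterval) : ℝ := (1 - (p : ℝ)) / p

lemma odds_pos {p : unitInterval} (hp : (1 / 2 : ℝ) < p) (hp1 : (p : ℝ) < 1) : 0 < odds p :=
  div_pos (by linarith) (by linarith)

lemma odds_lt_one {p : unitInterval} (hp : (1 / 2 : ℝ) < p) : odds p < 1 := by
  rw [odds, div_lt_one (by linarith)]; linarith

/-- The function `d ↦ (odds p) ^ d` is harmonic for the walk seen from its target. -/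
lemma odds_zpow_rec {p : unitInterval} (hp : (1 / 2 : ℝ) < p) (hp1 : (p : ℝ) < 1) (d : ℤ) :
    odds p ^ d = p * odds p ^ (d + 1) + (1 - p) * odds p ^ (d - 1) := by
  have h0 := (odds_pos hp hp1).ne'
  rw [zpow_add_one₀ h0, zpow_sub_one₀ h0]
  have : (0 : ℝ) < p := by linarith
  have h1 : (1 : ℝ) - p ≠ 0 := by linarith
  simp only [odds]
  field_simp
  ring

lemma visitsBy_le {p : unitInterval} (hp : (1 / 2 : ℝ) < p) (hp1 : (p : ℝ) < 1) (N : ℕ) (d : ℤ) :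
    (stepsLaw p).real (visitsBy N d) ≤ odds p ^ d := by
  have h0 := odds_pos hp hp1
  induction N generalizing d with
  | zero =>
    by_cases hd : d = 0
    · subst hd; simp
    · have : visitsBy 0 d = ∅ := by
        ext x; simp [visitsBy, Ne.symm hd]
      rw [this]; simp; positivity
  | succ N ih =>
    by_cases hd : d = 0
    · subst hd; simp
    · rw [visitsBy_rec p N hd, odds_zpow_rec hp hp1]
      have : (0 : ℝ) < p := by linarith
      have : (0 : ℝ) < 1 - p := by linarith
      gcongr
      · exact ih _
      · exact ih _

lemma hitProb_le {p : unitInterval} (hp : (1 / 2 : ℝ) < p) (hp1 : (p : ℝ) < 1) (d : ℤ) :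
    hitProb p d ≤ odds p ^ d := by
  have hU : visits d = ⋃ N, visitsBy N d := by
    ext x
    simp only [visits, visitsBy, Set.mem_ofPred_eq, Set.mem_iUnion]
    exact ⟨fun ⟨a, h⟩ => ⟨a, a, le_rfl, h⟩, fun ⟨_, a, _, h⟩ => ⟨a, h⟩⟩
  have hmono : Monotone fun N => visitsBy N d :=
    fun N M hNM x ⟨a, ha, h⟩ => ⟨a, ha.trans hNM, h⟩
  have := tendsto_measure_iUnion_atTop (μ := stepsLaw p) hmono
  rw [← hU] at this
  refine le_of_tendsto ((ENNReal.tendsto_toReal (measure_ne_top _ _)).comp this)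
    (Filter.Eventually.of_forall fun N => visitsBy_le hp hp1 N d)

/-- To the right of the origin, the successive differences of the hitting probabilities form a
geometric sequence of ratio `odds p`; as the probabilities tend to `0`, they are the powers of
`odds p`. -/
lemma hitProb_natCast {p : unitInterval} (hp : (1 / 2 : ℝ) < p) (hp1 : (p : ℝ) < 1) (d : ℕ) :
    hitProb p d = odds p ^ d := by
  have h0 := odds_pos hp hp1
  have h1 := odds_lt_one hp
  have hp0 : (0 : ℝ) < p := by linarith
  have hdiff : ∀ n : ℕ, hitProb p n - hitProb p (n + 1 : ℕ) =
      odds p ^ n * (1 - hitProb p 1) := by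
    intro n
    induction n with
    | zero => simp [hitProb_zero]
    | succ n ih =>
      have := hitProb_rec p (d := ((n + 1 : ℕ) : ℤ)) (by positivity)
      have e1 : ((n + 1 : ℕ) : ℤ) + 1 = ((n + 1 + 1 : ℕ) : ℤ) := by push_cast; ring
      have e2 : ((n + 1 : ℕ) : ℤ) - 1 = (n : ℤ) := by push_cast; ring
      rw [e1, e2] at this
      have e3 : hitProb p (n + 1 : ℕ) - hitProb p (n + 1 + 1 : ℕ) =
          odds p * (hitProb p n - hitProb p (n + 1 : ℕ)) := by
        rw [odds]; field_simp; linarith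
      rw [e3, ih]; ring
  have hsum : ∀ n : ℕ, (1 - odds p) * (1 - hitProb p n) =
      (1 - odds p ^ n) * (1 - hitProb p 1) := by
    intro n
    induction n with
    | zero => simp [hitProb_zero]
    | succ n ih =>
      have := hdiff n
      have e : hitProb p (n + 1 : ℕ) = hitProb p n - odds p ^ n * (1 - hitProb p 1) := by linarith
      rw [e, pow_succ]
      linear_combination ih
  have hpow := tendsto_pow_atTop_nhds_zero_of_lt_one h0.le h1
  have hlim : Filter.Tendsto (fun n : ℕ => hitProb p n) Filter.atTop (nhds 0) :=
    squeeze_zero (fun n => measureReal_nonneg)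
      (fun n => by simpa using hitProb_le hp hp1 (n : ℤ)) hpow
  have hone : (1 - odds p) * (1 - 0) = (1 - 0) * (1 - hitProb p 1) :=
    tendsto_nhds_unique (((hlim.const_sub 1).const_mul _).congr hsum)
      ((hpow.const_sub 1).mul_const _)
  have hd := hsum d
  rw [show 1 - hitProb p 1 = 1 - odds p by linarith] at hd
  have h2 : (1 - odds p) ≠ 0 := by linarith
  have h3 : 1 - hitProb p d = 1 - odds p ^ d := mul_left_cancel₀ h2 (by linarith)
  linarith

/-- To the left of the origin, the successive differences form a geometric sequence of ratio
`p / (1 - p) > 1`; as they are bounded, they vanish. -/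
lemma hitProb_neg_natCast {p : unitInterval} (hp : (1 / 2 : ℝ) < p) (hp1 : (p : ℝ) < 1) (d : ℕ) :
    hitProb p (-d) = 1 := by
  have h0 := odds_pos hp hp1
  have h1 := odds_lt_one hp
  have hp0 : (0 : ℝ) < p := by linarith
  have hdiff : ∀ n : ℕ, odds p ^ n * (hitProb p (-n) - hitProb p (-(n + 1 : ℕ))) =
      1 - hitProb p (-1) := by
    intro n
    induction n with
    | zero => simp [hitProb_zero]
    | succ n ih =>
      have := hitProb_rec p (d := -((n + 1 : ℕ) : ℤ)) (by push_cast; omega)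
      have e1 : -((n + 1 : ℕ) : ℤ) + 1 = -(n : ℤ) := by push_cast; ring
      have e2 : -((n + 1 : ℕ) : ℤ) - 1 = -((n + 1 + 1 : ℕ) : ℤ) := by push_cast; ring
      rw [e1, e2] at this
      rw [← ih, pow_succ, mul_assoc]
      congr 1
      rw [odds]; field_simp; linarith
  have hb : ∀ n : ℕ, |hitProb p (-n) - hitProb p (-(n + 1 : ℕ))| ≤ 1 := fun n =>
    abs_sub_le_of_nonneg_of_le measureReal_nonneg measureReal_le_one measureReal_nonneg
      measureReal_le_one
  have hz : (1 - hitProb p (-1)) = 0 := by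
    have hpow := tendsto_pow_atTop_nhds_zero_of_lt_one h0.le h1
    have : Filter.Tendsto (fun _ : ℕ => 1 - hitProb p (-1)) Filter.atTop (nhds 0) := by
      refine squeeze_zero_norm (fun n => ?_) hpow
      rw [← hdiff n, norm_mul, Real.norm_of_nonneg (by positivity)]
      exact mul_le_of_le_one_right (by positivity) (hb n)
    exact tendsto_nhds_unique tendsto_const_nhds this
  induction d with
  | zero => simp [hitProb_zero]
  | succ n ih =>
    have := hdiff n
    rw [hz, mul_eq_zero] at this
    have := this.resolve_left (by positivity)
    linarith

/-! ### Independence of the sites -/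

/-- The independent coordinates of a sample: the numbers of sleeping frogs, and the increment
sequences of the frogs. -/
abbrev Coord : Type := ℕ+ ⊕ Frog

/-- The σ-algebra generated by one coordinate. -/
@[reducible]
def coordSigma : Coord → MeasurableSpace Sample
  | .inl j => MeasurableSpace.comap (fun ω : Sample => ω.1 j) inferInstance
  | .inr i => MeasurableSpace.comap (fun ω : Sample => ω.2 i) inferInstance

/-- The site to which a coordinate belongs. -/
def Coord.site : Coord → ℕ
  | .inl j => j
  | .inr none => 0
  | .inr (some (j, _)) => j

/-- The σ-algebra generated by the coordinates that belong to the sites in `T`. -/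
@[reducible]
def sitesSigma (T : Set ℕ) : MeasurableSpace Sample := ⨆ x ∈ Coord.site ⁻¹' T, coordSigma x

lemma coordSigma_le (x : Coord) : coordSigma x ≤ (inferInstance : MeasurableSpace Sample) := by
  cases x with
  | inl j => exact ((measurable_pi_apply j).comp measurable_fst).comap_le
  | inr i => exact ((measurable_pi_apply i).comp measurable_snd).comap_le

lemma coordSigma_le_sitesSigma {x : Coord} {T : Set ℕ} (h : x.site ∈ T) :
    coordSigma x ≤ sitesSigma T :=
  le_iSup₂_of_le (f := fun x (_ : x ∈ Coord.site ⁻¹' T) => coordSigma x) x h le_rfl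

lemma sitesSigma_mono {T T' : Set ℕ} (h : T ⊆ T') : sitesSigma T ≤ sitesSigma T' :=
  iSup₂_le fun _ hx => coordSigma_le_sitesSigma (h hx)

lemma sitesSigma_le (T : Set ℕ) : sitesSigma T ≤ (inferInstance : MeasurableSpace Sample) :=
  iSup₂_le fun x _ => coordSigma_le x

/-- The law, a product of two infinite products, makes all coordinates independent. -/
lemma iIndep_coordSigma (p : unitInterval) (f : ℕ+ → ℝ≥0) : iIndep coordSigma (law p f) := by
  classical
  rw [iIndep_iff]
  intro s S hS
  have h1 : ∀ j, ∃ B : Set ℕ, MeasurableSet B ∧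
      (.inl j ∈ s → (fun ω : Sample => ω.1 j) ⁻¹' B = S (.inl j)) := by
    intro j
    by_cases h : .inl j ∈ s
    · obtain ⟨B, hB, e⟩ := hS _ h
      exact ⟨B, hB, fun _ => e⟩
    · exact ⟨Set.univ, MeasurableSet.univ, fun h' => absurd h' h⟩
  have h2 : ∀ i, ∃ B : Set (ℕ → ℤ), MeasurableSet B ∧
      (.inr i ∈ s → (fun ω : Sample => ω.2 i) ⁻¹' B = S (.inr i)) := by
    intro i
    by_cases h : .inr i ∈ s
    · obtain ⟨B, hB, e⟩ := hS _ h
      exact ⟨B, hB, fun _ => e⟩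
    · exact ⟨Set.univ, MeasurableSet.univ, fun h' => absurd h' h⟩
  choose B hB eB using h1
  choose C hC eC using h2
  have hB1 : ∀ j ∈ s.toLeft, law p f (S (.inl j)) = poissonMeasure (f j) (B j) := by
    intro j hj
    rw [← eB j (Finset.mem_toLeft.1 hj), law]
    have : (fun ω : Sample => ω.1 j) ⁻¹' B j = ((fun x : ℕ+ → ℕ => x j) ⁻¹' B j) ×ˢ Set.univ := by
      ext; simp
    rw [this, Measure.prod_prod, measure_univ, mul_one,
      ← Measure.map_apply (measurable_pi_apply j) (hB j), Measure.infinitePi_map_eval]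
  have hC1 : ∀ i ∈ s.toRight, law p f (S (.inr i)) = stepsLaw p (C i) := by
    intro i hi
    rw [← eC i (Finset.mem_toRight.1 hi), law]
    have : (fun ω : Sample => ω.2 i) ⁻¹' C i =
        Set.univ ×ˢ ((fun x : Frog → ℕ → ℤ => x i) ⁻¹' C i) := by
      ext; simp
    rw [this, Measure.prod_prod, measure_univ, one_mul,
      ← Measure.map_apply (measurable_pi_apply i) (hC i), Measure.infinitePi_map_eval]
  have hI : ⋂ i ∈ s, S i = (Set.pi s.toLeft B) ×ˢ (Set.pi s.toRight C) := by
    ext ω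
    simp only [Set.mem_iInter, Set.mem_prod, Set.mem_pi, Finset.mem_coe, Finset.mem_toLeft,
      Finset.mem_toRight]
    constructor
    · intro h
      refine ⟨fun j hj => ?_, fun i hi => ?_⟩
      · have := h _ hj; rw [← eB j hj] at this; exact this
      · have := h _ hi; rw [← eC i hi] at this; exact this
    · rintro ⟨hl, hr⟩ (j | i) hx
      · rw [← eB j hx]; exact hl j hx
      · rw [← eC i hx]; exact hr i hx
  rw [hI, law, Measure.prod_prod, Measure.infinitePi_pi _ fun j _ => hB j,
    Measure.infinitePi_pi _ fun i _ => hC i]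
  conv_rhs => rw [← Finset.toLeft_disjSum_toRight (u := s), Finset.prod_disjSum]
  exact congrArg₂ _ (Finset.prod_congr rfl fun j hj => (hB1 j hj).symm)
    (Finset.prod_congr rfl fun i hi => (hC1 i hi).symm)

/-- What happens at disjoint sets of sites is independent. -/
lemma law_real_inter_of_disjoint (p : unitInterval) (f : ℕ+ → ℝ≥0) {T T' : Set ℕ}
    (h : Disjoint T T') {A B : Set Sample} (hA : MeasurableSet[sitesSigma T] A)
    (hB : MeasurableSet[sitesSigma T'] B) :
    (law p f).real (A ∩ B) = (law p f).real A * (law p f).real B := by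
  have := (Indep_iff _ _ _).1 (indep_iSup_of_disjoint coordSigma_le (iIndep_coordSigma p f)
    (Disjoint.preimage Coord.site h)) A B hA hB
  rw [measureReal_def, this, ENNReal.toReal_mul]
  rfl

/-! ### The probability that a site is missed -/

/-- No frog of the site `s` visits `m`. Whether the frogs wake up plays no role: a frog is
considered to follow its walk from its starting point in any case. -/
def miss (s m : ℕ) : Set Sample :=
  {ω | ∀ i, start i = s → Present ω i → ω.2 i ∉ visits (m - s)}

/-- No frog of the sites `n, …, m - 1` visits `m`. -/
def allMiss (n m : ℕ) : Set Sample := {ω | ∀ s ∈ Finset.Ico n m, ω ∈ miss s m}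

lemma measurableSet_present (i : Frog) (s : ℕ) (h : start i = s) :
    MeasurableSet[sitesSigma {s}] {ω | Present ω i} := by
  match i with
  | none => simp [Present]
  | some (j, k) =>
    refine coordSigma_le_sitesSigma (x := .inl j) ?_ _ ?_
    · simpa [Coord.site, start] using h
    · exact ⟨{n | k < n}, measurableSet_lt measurable_const measurable_id, rfl⟩

lemma measurableSet_frog_visits (i : Frog) (s : ℕ) (h : start i = s) (d : ℤ) :
    MeasurableSet[sitesSigma {s}] {ω : Sample | ω.2 i ∈ visits d} := by
  refine coordSigma_le_sitesSigma (x := .inr i) ?_ _ ⟨visits d, measurableSet_visits d, rfl⟩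
  match i with
  | none => simpa [Coord.site, start, eq_comm] using h
  | some (j, k) => simpa [Coord.site, start] using h

lemma measurableSet_miss (s m : ℕ) : MeasurableSet[sitesSigma {s}] (miss s m) := by
  have : miss s m = ⋂ i, ⋂ (_ : start i = s),
      ({ω | Present ω i}ᶜ ∪ {ω : Sample | ω.2 i ∈ visits (m - s)}ᶜ) := by
    ext ω
    simp [miss, imp_iff_not_or]
  rw [this]
  refine @MeasurableSet.iInter _ _ (_) _ _ fun i => @MeasurableSet.iInter _ _ (_) _ _ fun h => ?_
  exact @MeasurableSet.union _ (_) _ _ (@MeasurableSet.compl _ _ (_) (measurableSet_present i s h))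
    (@MeasurableSet.compl _ _ (_) (measurableSet_frog_visits i s h _))

lemma allMiss_eq (n m : ℕ) : allMiss n m = ⋂ s ∈ Finset.Ico n m, miss s m := by
  ext; simp [allMiss]

lemma measurableSet_allMiss (n m : ℕ) : MeasurableSet[sitesSigma (Set.Ico n m)] (allMiss n m) := by
  rw [allMiss_eq]
  refine @Finset.measurableSet_biInter _ _ (_) _ _ fun s hs => ?_
  refine sitesSigma_mono ?_ _ (measurableSet_miss s m)
  simpa using hs

lemma start_eq_zero {i : Frog} (h : start i = (0 : ℕ)) : i = none := by
  match i with
  | none => rfl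
  | some (j, k) => exact absurd h (by simp [start])

lemma measurable_frog (i : Frog) : Measurable fun ω : Sample => ω.2 i :=
  (measurable_pi_apply i).comp measurable_snd

lemma map_frog_law (p : unitInterval) (f : ℕ+ → ℝ≥0) (i : Frog) :
    (law p f).map (fun ω => ω.2 i) = stepsLaw p := by
  have : (fun ω : Sample => ω.2 i) = (fun x : Frog → ℕ → ℤ => x i) ∘ Prod.snd := rfl
  rw [this, ← Measure.map_map (measurable_pi_apply i) measurable_snd, law,
    Measure.map_snd_prod, measure_univ, one_smul]
  exact Measure.infinitePi_map_eval (fun _ : Frog => stepsLaw p) i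

lemma law_real_miss_zero {p : unitInterval} (hp : (1 / 2 : ℝ) < p) (hp1 : (p : ℝ) < 1)
    (f : ℕ+ → ℝ≥0) (m : ℕ) : (law p f).real (miss 0 m) = 1 - odds p ^ m := by
  have h : miss 0 m = (fun ω : Sample => ω.2 none) ⁻¹' (visits m)ᶜ := by
    ext ω
    simp only [miss, Set.mem_preimage, Set.mem_compl_iff]
    constructor
    · intro h
      have := h none rfl trivial
      simpa using this
    · intro h i hi _
      rw [start_eq_zero hi]
      simpa using h
  rw [h, ← map_measureReal_apply (measurable_frog _) (measurableSet_visits _).compl,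
    map_frog_law, probReal_compl_eq_one_sub (measurableSet_visits _),
    ← hitProb_natCast hp hp1]
  rfl

/-- The frogs of the site `k` that visit `m` are a thinning of the Poisson number of sleeping
frogs. -/
lemma law_real_miss_pos {p : unitInterval} (hp : (1 / 2 : ℝ) < p) (hp1 : (p : ℝ) < 1)
    (f : ℕ+ → ℝ≥0) (k : ℕ+) {m : ℕ} (hkm : (k : ℕ) ≤ m) :
    (law p f).real (miss k m) = Real.exp (-(f k * odds p ^ (m - k))) := by
  classical
  set r : ℝ := odds p ^ (m - k) with hr
  have hV : (stepsLaw p).real (visits ((m : ℤ) - (k : ℕ)))ᶜ = 1 - r := by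
    rw [probReal_compl_eq_one_sub (measurableSet_visits _), hr, ← hitProb_natCast hp hp1,
      Nat.cast_sub hkm]
    rfl
  -- `D n`: there are `n` sleeping frogs at `k`, and none of them visits `m`.
  let D : ℕ → Set Sample := fun n => {x : ℕ+ → ℕ | x k = n} ×ˢ
    Set.pi ((Finset.range n).image fun l => (some (k, l) : Frog) : Finset Frog)
      fun _ => (visits ((m : ℤ) - (k : ℕ)))ᶜ
  have hU : miss k m = ⋃ n, D n := by
    ext ω
    simp only [miss, D, Set.mem_iUnion, Set.mem_prod, Set.mem_pi]
    constructor
    · intro h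
      refine ⟨ω.1 k, rfl, fun i hi => ?_⟩
      simp only [Finset.coe_image, Set.mem_image, Finset.mem_coe, Finset.mem_range] at hi
      obtain ⟨l, hl, rfl⟩ := hi
      exact h _ rfl hl
    · rintro ⟨n, hn, h⟩ i hi hP
      match i with
      | none => exact absurd hi.symm (by simp [start])
      | some (j, l) =>
        obtain rfl : j = k := by simpa [start] using hi
        refine h _ ?_
        simp only [Finset.coe_image, Set.mem_image, Finset.mem_coe, Finset.mem_range]
        exact ⟨l, by rw [← show ω.1 j = n from hn]; exact hP, rfl⟩
  have hDm : ∀ n, MeasurableSet (D n) := fun n =>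
    MeasurableSet.prod (measurable_pi_apply (X := fun _ : ℕ+ => ℕ) k (measurableSet_singleton n))
      (MeasurableSet.pi (Finset.countable_toSet _) fun _ _ => (measurableSet_visits _).compl)
  have hDd : Pairwise (Function.onFun Disjoint D) := by
    intro n n' hn
    refine Set.disjoint_left.2 fun ω h h' => hn ?_
    exact h.1.symm.trans h'.1
  have hD : ∀ n, (law p f).real (D n) = Real.exp (-(f k)) * (f k : ℝ) ^ n / n.factorial *
      (1 - r) ^ n := by
    intro n
    rw [law, measureReal_prod_prod]
    congr 1
    · rw [← poissonMeasure_real_singleton, ← Measure.infinitePi_map_eval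
        (fun j => poissonMeasure (f j)) k,
        map_measureReal_apply (measurable_pi_apply k) (measurableSet_singleton n)]
      rfl
    · rw [measureReal_def, Measure.infinitePi_pi _ fun _ _ => (measurableSet_visits _).compl,
        Finset.prod_const, ENNReal.toReal_pow, ← measureReal_def, hV,
        Finset.card_image_of_injective _ fun a b h => by simpa using h, Finset.card_range]
  have hs : HasSum (fun n => (law p f).real (D n)) (Real.exp (-(f k * r))) := by
    have h := (NormedSpace.expSeries_div_hasSum_exp ((f k : ℝ) * (1 - r))).mul_left
      (Real.exp (-(f k)))
    rw [← Real.exp_eq_exp_ℝ, ← Real.exp_add] at h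
    have e : (fun n => (law p f).real (D n)) = fun n : ℕ =>
        Real.exp (-(f k)) * (((f k : ℝ) * (1 - r)) ^ n / n.factorial) := by
      ext n
      rw [hD, mul_pow]
      ring
    rw [e, show -((f k : ℝ) * r) = -(f k) + f k * (1 - r) by ring]
    exact h
  rw [hU]
  have h2 : HasSum (fun n => (law p f).real (D n)) ((law p f).real (⋃ n, D n)) := by
    have hne : ∑' n, law p f (D n) ≠ ∞ := by
      rw [← measure_iUnion hDd hDm]
      exact measure_ne_top _ _
    rw [measureReal_def, measure_iUnion hDd hDm,
      ENNReal.tsum_toReal_eq (ENNReal.ne_top_of_tsum_ne_top hne)]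
    exact ENNReal.hasSum_toReal hne
  exact h2.unique hs

/-- The mean number of sleeping frogs as a function on `ℕ`; its value at `0` is `0`. -/
noncomputable def meanAt (f : ℕ+ → ℝ≥0) (s : ℕ) : ℝ := if h : 0 < s then f ⟨s, h⟩ else 0

/-- The mean number of frogs from the sites `n, …, m - 1` that would visit `m`. -/
noncomputable def meanVisits (p : unitInterval) (f : ℕ+ → ℝ≥0) (n m : ℕ) : ℝ :=
  ∑ s ∈ Finset.Ico n m, meanAt f s * odds p ^ (m - s)

lemma law_real_allMiss {p : unitInterval} (hp : (1 / 2 : ℝ) < p) (hp1 : (p : ℝ) < 1)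
    (f : ℕ+ → ℝ≥0) {n m : ℕ} (hn : 0 < n) :
    (law p f).real (allMiss n m) = Real.exp (-meanVisits p f n m) := by
  have key : ∀ T : Finset ℕ, (∀ s ∈ T, 0 < s ∧ s ≤ m) →
      (law p f).real (⋂ s ∈ T, miss s m) =
        Real.exp (-∑ s ∈ T, meanAt f s * odds p ^ (m - s)) := by
    intro T
    induction T using Finset.induction_on with
    | empty => simp
    | insert a T ha ih =>
      intro h
      rw [Finset.set_biInter_insert, law_real_inter_of_disjoint p f (T := {a}) (T' := T)
        (by simpa using ha) (measurableSet_miss a m) ?_,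
        ih fun s hs => h s (Finset.mem_insert_of_mem hs), Finset.sum_insert ha]
      · obtain ⟨h0, hm⟩ := h a (Finset.mem_insert_self _ _)
        have := law_real_miss_pos hp hp1 f ⟨a, h0⟩ hm
        rw [PNat.mk_coe] at this
        rw [this, ← Real.exp_add, meanAt, dif_pos h0]
        congr 1
        ring
      · refine @Finset.measurableSet_biInter _ _ (_) _ _ fun s hs => ?_
        exact sitesSigma_mono (by simpa using hs) _ (measurableSet_miss s m)
  rw [allMiss_eq, key _ fun s hs => ?_]
  · rfl
  · rw [Finset.mem_Ico] at hs
    omega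

lemma law_real_allMiss_zero {p : unitInterval} (hp : (1 / 2 : ℝ) < p) (hp1 : (p : ℝ) < 1)
    (f : ℕ+ → ℝ≥0) {m : ℕ} (hm : 0 < m) :
    (law p f).real (allMiss 0 m) = (1 - odds p ^ m) * Real.exp (-meanVisits p f 1 m) := by
  have : allMiss 0 m = miss 0 m ∩ allMiss 1 m := by
    rw [allMiss_eq, allMiss_eq, ← Finset.insert_Ico_add_one_left_eq_Ico hm,
      Finset.set_biInter_insert, zero_add]
  rw [this, law_real_inter_of_disjoint p f (T := {0}) (T' := Set.Ico 1 m) (by simp)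
    (measurableSet_miss 0 m) (measurableSet_allMiss 1 m), law_real_miss_zero hp hp1,
    law_real_allMiss hp hp1 f one_pos]

/-! ### The dynamics for a fixed sample -/

lemma state_succ_of_some {ω : Sample} {n a : ℕ} {i : Frog} (h : state ω n i = some a) :
    state ω (n + 1) i = some (a + 1) := by
  simp [state, h]

lemma state_succ_of_none {ω : Sample} {n : ℕ} {i : Frog} (h : state ω n i = none)
    (hi : Present ω i) {i' : Frog} {a : ℕ} (h' : state ω n i' = some a)
    (hp : position ω i' (a + 1) = start i) : state ω (n + 1) i = some 0 := by
  simp only [state, h]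
  exact if_pos ⟨hi, i', a, h', hp⟩

/-- A frog is active at time `n + 1` because it was active before, or because it was woken up. -/
lemma state_succ_eq_some {ω : Sample} {n b : ℕ} {i : Frog} (h : state ω (n + 1) i = some b) :
    (∃ a, state ω n i = some a) ∨
      (b = 0 ∧ Present ω i ∧
        ∃ i' a, state ω n i' = some a ∧ position ω i' (a + 1) = start i) := by
  cases hs : state ω n i with
  | some a => exact Or.inl ⟨a, rfl⟩
  | none =>
    right
    simp only [state, hs] at h
    split_ifs at h with hc
    exact ⟨by simpa using h.symm, hc⟩

/-- The frog `i` is woken up at some time. -/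
def Activated (ω : Sample) (i : Frog) : Prop := ∃ n a, state ω n i = some a

lemma Activated.exists_state_zero {ω : Sample} {i : Frog} (h : Activated ω i) :
    ∃ n, state ω n i = some 0 := by
  obtain ⟨n, a, h⟩ := h
  induction n generalizing a with
  | zero =>
    by_cases hi : i = none
    · exact ⟨0, by simp [state, hi]⟩
    · simp [state, hi] at h
  | succ n ih =>
    rcases state_succ_eq_some h with ⟨a', h'⟩ | ⟨rfl, _⟩
    · exact ih a' h'
    · exact ⟨n + 1, h⟩

/-- A frog that is woken up makes all the steps of its walk. -/
lemma Activated.exists_state {ω : Sample} {i : Frog} (h : Activated ω i) (a : ℕ) :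
    ∃ n, state ω n i = some a := by
  induction a with
  | zero => exact h.exists_state_zero
  | succ a ih =>
    obtain ⟨n, hn⟩ := ih
    exact ⟨n + 1, state_succ_of_some hn⟩

lemma activated_none (ω : Sample) : Activated ω none := ⟨0, 0, by simp [state]⟩

/-- A frog wakes up the frogs of the sites, other than its own, which it visits. -/
lemma Activated.wake {ω : Sample} {i i' : Frog} (h : Activated ω i) (hi' : Present ω i')
    (hne : start i ≠ start i') {a : ℕ} (ha : position ω i a = start i') : Activated ω i' := by
  cases a with
  | zero => simp [position] at ha; exact absurd ha hne
  | succ a =>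
    obtain ⟨n, hn⟩ := h.exists_state a
    cases hs : state ω n i' with
    | some b => exact ⟨n, b, hs⟩
    | none => exact ⟨n + 1, 0, state_succ_of_none hs hi' hn ha⟩

lemma exists_start (i : Frog) : ∃ s : ℕ, start i = s := by
  match i with
  | none => exact ⟨0, rfl⟩
  | some (j, _) => exact ⟨j, rfl⟩

lemma notMem_allMiss_iff {ω : Sample} {n m : ℕ} : ω ∉ allMiss n m ↔
    ∃ s, n ≤ s ∧ s < m ∧ ∃ i, start i = s ∧ Present ω i ∧ ∃ a, position ω i a = m := by
  simp only [allMiss, miss, visits, position, Set.mem_ofPred_eq, not_forall, not_not,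
    Finset.mem_Ico, exists_prop]
  constructor
  · rintro ⟨s, ⟨h1, h2⟩, i, hi, hP, a, ha⟩
    exact ⟨s, h1, h2, i, hi, hP, a, by rw [hi, ha]; ring⟩
  · rintro ⟨s, h1, h2, i, hi, hP, a, ha⟩
    exact ⟨s, ⟨h1, h2⟩, i, hi, hP, a, by rw [← ha, hi]; ring⟩

/-- If every site is visited by some frog from its left, then all frogs wake up. -/
lemma activated_of_forall_notMem_allMiss {ω : Sample} (h : ∀ m, 0 < m → ω ∉ allMiss 0 m)
    {i : Frog} (hi : Present ω i) : Activated ω i := by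
  obtain ⟨s, hs⟩ := exists_start i
  induction s using Nat.strong_induction_on generalizing i with
  | _ s ih =>
    rcases Nat.eq_zero_or_pos s with rfl | hpos
    · rw [start_eq_zero hs]
      exact activated_none ω
    · obtain ⟨t, _, hts, i', hi', hP, a, ha⟩ := notMem_allMiss_iff.1 (h s hpos)
      refine (ih t hts hP hi').wake hi ?_ (ha.trans hs.symm)
      rw [hs, hi']
      exact_mod_cast hts.ne

/-- A nearest-neighbour path that starts below `m` and does not visit `m` stays below `m`. -/
lemma position_lt {ω : Sample} {i : Frog} (hstep : ∀ k, ω.2 i k = -1 ∨ ω.2 i k = 1) {m : ℤ}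
    (hs : start i < m) {a : ℕ} (h : ∀ b ≤ a, position ω i b ≠ m) : position ω i a < m := by
  induction a with
  | zero => simpa [position] using hs
  | succ a ih =>
    have h1 := ih fun b hb => h b (by omega)
    have h2 := h (a + 1) le_rfl
    have h3 : position ω i (a + 1) = position ω i a + ω.2 i a := by
      simp [position, Finset.sum_range_succ, add_assoc]
    rcases hstep a with h4 | h4 <;> omega

/-- If no frog from the left of `m` visits `m`, then only frogs from the left of `m` ever wake
up. -/
lemma Activated.start_lt {ω : Sample} (hstep : ∀ i k, ω.2 i k = -1 ∨ ω.2 i k = 1) {m : ℕ}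
    (hm : 0 < m) (h : ω ∈ allMiss 0 m) {i : Frog} (hi : Activated ω i) :
    Present ω i ∧ start i < m := by
  obtain ⟨n, a, hn⟩ := hi
  induction n generalizing i a with
  | zero =>
    by_cases hi : i = none
    · subst hi
      exact ⟨trivial, by simpa [start] using hm⟩
    · simp [state, hi] at hn
  | succ n ih =>
    rcases state_succ_eq_some hn with ⟨a', h'⟩ | ⟨_, hP, i', a', h', hpos⟩
    · exact ih a' h'
    · refine ⟨hP, ?_⟩
      obtain ⟨hP', hlt⟩ := ih a' h'
      rw [← hpos]
      refine position_lt (hstep i') hlt fun b _ hb => ?_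
      obtain ⟨s, hs⟩ := exists_start i'
      exact notMem_allMiss_iff.2 ⟨s, Nat.zero_le _, by rw [hs] at hlt; exact_mod_cast hlt, i', hs,
        hP', b, hb⟩ h

lemma finite_present_lt (ω : Sample) (m : ℕ) : {i | Present ω i ∧ start i < m}.Finite := by
  have : {i | Present ω i ∧ start i < m} ⊆ insert none
      (⋃ j ∈ {j : ℕ+ | (j : ℕ) < m}, (fun k => some (j, k)) '' Set.Iio (ω.1 j)) := by
    rintro (_ | ⟨j, k⟩) ⟨h1, h2⟩
    · exact Set.mem_insert _ _
    · refine Set.mem_insert_of_mem _ (Set.mem_biUnion (x := j) ?_ ⟨k, h1, rfl⟩)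
      simpa [start] using h2
  refine Set.Finite.subset (Set.Finite.insert _ (Set.Finite.biUnion ?_ fun j _ =>
    (Set.finite_Iio _).image _)) this
  exact Set.Finite.preimage PNat.coe_injective.injOn (Set.finite_Iio m)

/-- If some site is not visited by the frogs from its left, then only finitely many frogs hit the
origin. -/
lemma finite_hitsOrigin {ω : Sample} (hstep : ∀ i k, ω.2 i k = -1 ∨ ω.2 i k = 1) {m : ℕ}
    (hm : 0 < m) (h : ω ∈ allMiss 0 m) : {i | HitsOrigin ω i}.Finite :=
  (finite_present_lt ω m).subset fun _ ⟨n, a, hn, _⟩ =>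
    Activated.start_lt hstep hm h ⟨n, a, hn⟩

/-- If every site is visited by a frog from its left, every frog visits the origin, and every frog
visits only finitely many sites to the right of its starting point, then infinitely many frogs hit
the origin. -/
lemma infinite_hitsOrigin {ω : Sample} (h : ∀ m, 0 < m → ω ∉ allMiss 0 m)
    (h0 : ∀ i, ∃ a, position ω i a = 0)
    (hfin : ∀ i, {m : ℕ | ∃ a, position ω i a = m}.Finite) :
    {i | HitsOrigin ω i}.Infinite := by
  intro hf
  have hcover : Set.Ioi 0 ⊆ ⋃ i ∈ {i | HitsOrigin ω i}, {m : ℕ | ∃ a, position ω i a = m} := by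
    intro m hm
    obtain ⟨s, _, _, i, _, hP, a, ha⟩ := notMem_allMiss_iff.1 (h m hm)
    refine Set.mem_biUnion (x := i) ?_ ⟨a, ha⟩
    obtain ⟨b, hb⟩ := h0 i
    obtain ⟨n, hn⟩ := (activated_of_forall_notMem_allMiss h hP).exists_state b
    exact ⟨n, b, hn, hb⟩
  exact Set.Ioi_infinite 0 ((hf.biUnion fun i _ => hfin i).subset hcover)

/-! ### Analysis of the gap probabilities -/

/-- The probability that no frog of the sites `1, …, m - 1` visits `m`. -/
noncomputable def gapProb (p : unitInterval) (f : ℕ+ → ℝ≥0) (m : ℕ) : ℝ :=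
  Real.exp (-meanVisits p f 1 m)

lemma gapProb_pos (p : unitInterval) (f : ℕ+ → ℝ≥0) (m : ℕ) : 0 < gapProb p f m := Real.exp_pos _

lemma meanAt_nonneg (f : ℕ+ → ℝ≥0) (s : ℕ) : 0 ≤ meanAt f s := by
  unfold meanAt
  split_ifs
  · exact NNReal.coe_nonneg _
  · exact le_rfl

lemma meanAt_mono {f : ℕ+ → ℝ≥0} (hf : Monotone f) : Monotone (meanAt f) := by
  intro s t hst
  by_cases hs : 0 < s
  · have ht : 0 < t := hs.trans_le hst
    simp only [meanAt, hs, ht, dif_pos]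
    exact_mod_cast hf (show (⟨s, hs⟩ : ℕ+) ≤ ⟨t, ht⟩ from hst)
  · simp only [meanAt, hs]
    exact meanAt_nonneg f t

lemma meanAt_coe (f : ℕ+ → ℝ≥0) (j : ℕ+) : meanAt f j = f j := by
  rw [meanAt, dif_pos j.pos]
  rfl

lemma meanVisits_succ (p : unitInterval) (f : ℕ+ → ℝ≥0) {n m : ℕ} (h : n ≤ m) :
    meanVisits p f n (m + 1) = odds p * (meanVisits p f n m + meanAt f m) := by
  rw [meanVisits, meanVisits, Finset.sum_Ico_succ_top h, mul_add, Finset.mul_sum]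
  congr 1
  · refine Finset.sum_congr rfl fun s hs => ?_
    rw [Nat.succ_sub (Finset.mem_Ico.1 hs).2.le, pow_succ]
    ring
  · rw [Nat.add_sub_cancel_left, pow_one, mul_comm]

/-- As the means increase, the sites `n, …, m - 1` send at least as many frogs to `m` as the
sites `1, …, m - n` send to `m - n + 1`. -/
lemma meanVisits_shift_le {p : unitInterval} (hp : (1 / 2 : ℝ) < p) (hp1 : (p : ℝ) < 1)
    {f : ℕ+ → ℝ≥0} (hf : Monotone f) (l j : ℕ) :
    meanVisits p f 1 l ≤ meanVisits p f (1 + j) (l + j) := by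
  rw [meanVisits, meanVisits, ← Finset.sum_Ico_add']
  have := odds_pos hp hp1
  refine Finset.sum_le_sum fun s _ => ?_
  rw [Nat.add_sub_add_right]
  gcongr
  exact meanAt_mono hf (Nat.le_add_right s j)

lemma odds_div_one_sub {p : unitInterval} (hp : (1 / 2 : ℝ) < p) :
    (1 - (p : ℝ)) / (2 * p - 1) = odds p / (1 - odds p) := by
  have h1 : (0 : ℝ) < p := by linarith
  have h2 : 2 * (p : ℝ) - 1 ≠ 0 := by linarith
  have h3 : 1 - odds p = (2 * p - 1) / p := by rw [odds]; field_simp; ring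
  rw [h3, odds]
  field_simp

/-- As the means increase, each of them can be replaced by the last one, and the geometric series
`∑ i ≥ 1, odds p ^ i` has the value `(1 - p) / (2 p - 1)`. -/
lemma meanVisits_le {p : unitInterval} (hp : (1 / 2 : ℝ) < p) (hp1 : (p : ℝ) < 1)
    {f : ℕ+ → ℝ≥0} (hf : Monotone f) (m : ℕ) :
    meanVisits p f 1 (m + 1) ≤ (1 - (p : ℝ)) / (2 * p - 1) * meanAt f m := by
  have h0 := odds_pos hp hp1
  have h1 : 0 < 1 - odds p := sub_pos.2 (odds_lt_one hp)
  rw [odds_div_one_sub hp]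
  induction m with
  | zero => simp [meanVisits, meanAt]
  | succ m ih =>
    have h2 := meanAt_mono hf (Nat.le_succ m)
    rw [meanVisits_succ p f (by omega)]
    calc odds p * (meanVisits p f 1 (m + 1) + meanAt f (m + 1))
        ≤ odds p * (odds p / (1 - odds p) * meanAt f (m + 1) + meanAt f (m + 1)) := by
          gcongr
          exact ih.trans (by gcongr)
      _ = odds p / (1 - odds p) * meanAt f (m + 1) := by
          field_simp
          ring

/-- By the convexity of `exp`, `gapProb` at `m + 1` is at most an average of `gapProb` at `m`
and the term of the series in the criterion. -/
lemma gapProb_succ_le {p : unitInterval} (hp : (1 / 2 : ℝ) < p) (hp1 : (p : ℝ) < 1)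
    (f : ℕ+ → ℝ≥0) {m : ℕ} (hm : 1 ≤ m) :
    gapProb p f (m + 1) ≤ odds p * gapProb p f m +
      (1 - odds p) * Real.exp (-((1 - (p : ℝ)) / (2 * p - 1) * meanAt f m)) := by
  have h0 := odds_pos hp hp1
  have h1 : 0 < 1 - odds p := sub_pos.2 (odds_lt_one hp)
  rw [odds_div_one_sub hp, gapProb, gapProb, meanVisits_succ p f hm]
  have := convexOn_exp.2 (Set.mem_univ (-meanVisits p f 1 m))
    (Set.mem_univ (-(odds p / (1 - odds p) * meanAt f m))) h0.le h1.le (by ring)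
  simp only [smul_eq_mul] at this
  refine le_of_eq_of_le ?_ this
  congr 1
  field_simp
  ring

/-- Summing `gapProb_succ_le` bounds the partial sums of `gapProb`; monotonicity of the means is
not needed. -/
lemma summable_gapProb {p : unitInterval} (hp : (1 / 2 : ℝ) < p) (hp1 : (p : ℝ) < 1)
    {f : ℕ+ → ℝ≥0}
    (hs : Summable fun m : ℕ =>
      Real.exp (-((1 - (p : ℝ)) / (2 * p - 1) * meanAt f (m + 1)))) :
    Summable fun m => gapProb p f (m + 1) := by
  have h0 := odds_pos hp hp1
  have h1 : 0 < 1 - odds p := sub_pos.2 (odds_lt_one hp)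
  set a : ℕ → ℝ := fun m => Real.exp (-((1 - (p : ℝ)) / (2 * p - 1) * meanAt f (m + 1))) with ha
  refine summable_of_sum_range_le (c := (gapProb p f 1 + (1 - odds p) * ∑' m, a m) / (1 - odds p))
    (fun m => (gapProb_pos p f _).le) fun N => ?_
  rw [le_div_iff₀ h1]
  have e1 : ∑ m ∈ Finset.range (N + 1), gapProb p f (m + 1) ≤ gapProb p f 1 +
      (odds p * ∑ m ∈ Finset.range N, gapProb p f (m + 1) +
        (1 - odds p) * ∑ m ∈ Finset.range N, a m) := by
    rw [Finset.sum_range_succ', add_comm, Finset.mul_sum, Finset.mul_sum,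
      ← Finset.sum_add_distrib]
    refine add_le_add le_rfl (Finset.sum_le_sum fun m _ => ?_)
    exact gapProb_succ_le hp hp1 f (by omega)
  have e2 : ∑ m ∈ Finset.range N, a m ≤ ∑' m, a m :=
    hs.sum_le_tsum _ fun m _ => (Real.exp_pos _).le
  have e3 := mul_le_mul_of_nonneg_left e2 h1.le
  -- `e1` bounds the partial sum `U` by `gapProb 1 + odds * U + (1 - odds) * ∑ a`.
  rw [Finset.sum_range_succ] at e1
  linarith [gapProb_pos p f (N + 1)]

/-! ### Almost sure properties of the walks -/

lemma ae_steps (p : unitInterval) (f : ℕ+ → ℝ≥0) :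
    ∀ᵐ ω ∂(law p f), ∀ i k, ω.2 i k = -1 ∨ ω.2 i k = 1 := by
  refine ae_all_iff.2 fun i => ?_
  have h := ae_step p
  rw [← map_frog_law p f i] at h
  exact ae_of_ae_map (measurable_frog i).aemeasurable h

/-- As the walks drift to the left, every frog visits the origin. -/
lemma ae_position_eq_zero {p : unitInterval} (hp : (1 / 2 : ℝ) < p) (hp1 : (p : ℝ) < 1)
    (f : ℕ+ → ℝ≥0) : ∀ᵐ ω ∂(law p f), ∀ i, ∃ a, position ω i a = 0 := by
  refine ae_all_iff.2 fun i => ?_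
  obtain ⟨s, hs⟩ := exists_start i
  have h : ∀ᵐ x ∂(stepsLaw p), x ∈ visits (-(s : ℤ)) := by
    have h1 := hitProb_neg_natCast hp hp1 s
    rw [hitProb, measureReal_def, ENNReal.toReal_eq_one_iff] at h1
    exact (mem_ae_iff_prob_eq_one (measurableSet_visits _)).2 h1
  rw [← map_frog_law p f i] at h
  filter_upwards [ae_of_ae_map (measurable_frog i).aemeasurable h] with ω hω
  obtain ⟨a, ha⟩ := hω
  exact ⟨a, by rw [position, hs, ha]; ring⟩

/-- By the Borel–Cantelli lemma, every frog visits only finitely many sites to the right of the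
origin. -/
lemma ae_finite_visited {p : unitInterval} (hp : (1 / 2 : ℝ) < p) (hp1 : (p : ℝ) < 1)
    (f : ℕ+ → ℝ≥0) :
    ∀ᵐ ω ∂(law p f), ∀ i, {m : ℕ | ∃ a, position ω i a = m}.Finite := by
  refine ae_all_iff.2 fun i => ?_
  have h0 := odds_pos hp hp1
  have h : ∀ᵐ x ∂(stepsLaw p), {m : ℕ | x ∈ visits (m - start i)}.Finite := by
    refine ae_finite_setOfPred_mem ?_
    have hsum : Summable fun m : ℕ => odds p ^ ((m : ℤ) - start i) := by
      simp_rw [zpow_sub₀ h0.ne', zpow_natCast]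
      exact (summable_geometric_of_lt_one h0.le (odds_lt_one hp)).div_const _
    refine ne_top_of_le_ne_top hsum.tsum_ofReal_ne_top (ENNReal.tsum_le_tsum fun m => ?_)
    rw [← ofReal_measureReal]
    exact ENNReal.ofReal_le_ofReal (hitProb_le hp hp1 _)
  rw [← map_frog_law p f i] at h
  filter_upwards [ae_of_ae_map (measurable_frog i).aemeasurable h] with ω hω
  refine hω.subset ?_
  rintro m ⟨a, ha⟩
  exact ⟨a, by rw [← ha, position]; ring⟩

/-! ### The renewal inequality and transience -/

lemma allMiss_subset {n n' m : ℕ} (h : n ≤ n') : allMiss n m ⊆ allMiss n' m :=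
  fun _ hω s hs => hω s (Finset.Ico_subset_Ico_left h hs)

lemma measurableSet_allMiss_ambient (n m : ℕ) : MeasurableSet (allMiss n m) :=
  sitesSigma_le _ _ (measurableSet_allMiss n m)

/-- The site `n + 1` is the first one that is not visited by a frog from its left. -/
def firstMiss (n : ℕ) : Set Sample :=
  allMiss 0 (n + 1) ∩ ⋂ j ∈ Finset.range n, (allMiss 0 (j + 1))ᶜ

lemma measurableSet_firstMiss (n : ℕ) : MeasurableSet[sitesSigma (Set.Ico 0 (n + 1))]
    (firstMiss n) := by
  refine @MeasurableSet.inter _ (_) _ _ (measurableSet_allMiss _ _) ?_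
  refine @Finset.measurableSet_biInter _ _ (_) _ _ fun j hj => ?_
  refine @MeasurableSet.compl _ _ (_) (sitesSigma_mono ?_ _ (measurableSet_allMiss _ _))
  exact Set.Ico_subset_Ico_right (by have := Finset.mem_range.1 hj; omega)

lemma pairwise_disjoint_firstMiss : Pairwise (Function.onFun Disjoint firstMiss) := by
  have key : ∀ n n', n < n' → Disjoint (firstMiss n) (firstMiss n') := fun n n' h =>
    Set.disjoint_left.2 fun ω h1 h2 =>
      Set.mem_iInter₂.1 h2.2 n (Finset.mem_range.2 h) h1.1
  intro n n' h
  rcases h.lt_or_gt with h | h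
  · exact key _ _ h
  · exact (key _ _ h).symm

lemma allMiss_subset_biUnion_firstMiss (m : ℕ) : allMiss 0 (m + 1) ⊆
    ⋃ n ∈ Finset.range (m + 1), firstMiss n ∩ allMiss (n + 1) (m + 1) := by
  classical
  intro ω hω
  have hex : ∃ n, ω ∈ allMiss 0 (n + 1) := ⟨m, hω⟩
  refine Set.mem_biUnion (x := Nat.find hex) ?_ ⟨⟨Nat.find_spec hex, ?_⟩, ?_⟩
  · simpa [Nat.lt_succ_iff] using Nat.find_min' hex hω
  · refine Set.mem_iInter₂.2 fun j hj => Nat.find_min hex (Finset.mem_range.1 hj)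
  · exact allMiss_subset (Nat.zero_le _) hω

/-- Renewal inequality: given that `n + 1` is the first site not visited from its left, a later
site `m + 1` is missed with probability at most that of `m - n + 1` being missed by the frogs of
the sites `1, …, m - n`. -/
lemma law_real_allMiss_le {p : unitInterval} (hp : (1 / 2 : ℝ) < p) (hp1 : (p : ℝ) < 1)
    {f : ℕ+ → ℝ≥0} (hf : Monotone f) (m : ℕ) :
    (law p f).real (allMiss 0 (m + 1)) ≤
      ∑ n ∈ Finset.range (m + 1), (law p f).real (firstMiss n) * gapProb p f (m - n + 1) := by
  refine (measureReal_mono (allMiss_subset_biUnion_firstMiss m) (measure_ne_top _ _)).trans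
    ((measureReal_biUnion_finset_le _ _).trans (Finset.sum_le_sum fun n hn => ?_))
  have hn' : n ≤ m := by have := Finset.mem_range.1 hn; omega
  rw [law_real_inter_of_disjoint p f (T := Set.Ico 0 (n + 1)) (T' := Set.Ico (n + 1) (m + 1))
    (Set.Ico_disjoint_Ico_same) (measurableSet_firstMiss n) (measurableSet_allMiss _ _),
    law_real_allMiss hp hp1 f (Nat.succ_pos n)]
  gcongr
  refine Real.exp_le_exp.2 (neg_le_neg ?_)
  have := meanVisits_shift_le hp hp1 hf (m - n + 1) n
  rwa [show 1 + n = n + 1 by ring, show m - n + 1 + n = m + 1 by omega] at this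

/-- If the expected number of sites that are not visited from their left is infinite, then almost
surely there is such a site. -/
lemma law_real_iUnion_allMiss {p : unitInterval} (hp : (1 / 2 : ℝ) < p) (hp1 : (p : ℝ) < 1)
    {f : ℕ+ → ℝ≥0} (hf : Monotone f) (hs : ¬ Summable fun m => gapProb p f (m + 1)) :
    (law p f).real (⋃ m, allMiss 0 (m + 1)) = 1 := by
  have h0 := odds_pos hp hp1
  have h1 : 0 < 1 - odds p := sub_pos.2 (odds_lt_one hp)
  refine le_antisymm measureReal_le_one ?_
  by_contra! hlt
  set θ := (law p f).real (⋃ m, allMiss 0 (m + 1)) with hθ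
  have h2 : 0 < 1 - θ := sub_pos.2 hlt
  -- With `U` the partial sum of `gapProb`, the renewal inequality summed over `m` gives
  -- `U - C ≤ θ * U`, so that `θ < 1` bounds `U`; `C` accounts for the frog
  -- that starts at the origin.
  have hg : Summable fun m : ℕ => odds p ^ (m + 1) :=
    (summable_nat_add_iff 1).2 (summable_geometric_of_lt_one h0.le (odds_lt_one hp))
  refine hs (summable_of_sum_range_le (c := (∑' m : ℕ, odds p ^ (m + 1)) / (1 - θ))
    (fun m => (gapProb_pos p f _).le) fun N => ?_)
  set U := ∑ m ∈ Finset.range N, gapProb p f (m + 1) with hU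
  have hU0 : 0 ≤ U := Finset.sum_nonneg fun m _ => (gapProb_pos p f _).le
  have hτ : ∑ n ∈ Finset.range N, (law p f).real (firstMiss n) ≤ θ := by
    rw [← measureReal_biUnion_finset (fun i _ j _ h => pairwise_disjoint_firstMiss h)
      fun n _ => sitesSigma_le _ _ (measurableSet_firstMiss n)]
    refine measureReal_mono (Set.iUnion₂_subset fun n _ => ?_)
    exact Set.inter_subset_left.trans (Set.subset_iUnion (fun m => allMiss 0 (m + 1)) n)
  have e1 : ∑ m ∈ Finset.range N, (law p f).real (allMiss 0 (m + 1)) ≤ θ * U := by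
    refine (Finset.sum_le_sum fun m _ => law_real_allMiss_le hp hp1 hf m).trans ?_
    rw [Finset.sum_range_diag_flip N fun n l =>
      (law p f).real (firstMiss n) * gapProb p f (l + 1)]
    refine le_trans (Finset.sum_le_sum fun n _ => ?_) ((Finset.sum_mul _ _ _).symm.le.trans
      (mul_le_mul_of_nonneg_right hτ hU0))
    rw [← Finset.mul_sum]
    refine mul_le_mul_of_nonneg_left ?_ measureReal_nonneg
    exact Finset.sum_le_sum_of_subset_of_nonneg (Finset.range_mono (Nat.sub_le _ _))
      fun m _ _ => (gapProb_pos p f _).le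
  have e2 : U - ∑' m : ℕ, odds p ^ (m + 1) ≤
      ∑ m ∈ Finset.range N, (law p f).real (allMiss 0 (m + 1)) := by
    have e3 : ∑ m ∈ Finset.range N, odds p ^ (m + 1) ≤ ∑' m : ℕ, odds p ^ (m + 1) :=
      hg.sum_le_tsum _ fun m _ => by positivity
    refine (sub_le_sub_left e3 U).trans ?_
    rw [hU, ← Finset.sum_sub_distrib]
    refine Finset.sum_le_sum fun m _ => ?_
    rw [law_real_allMiss_zero hp hp1 f (Nat.succ_pos m)]
    have e4 : gapProb p f (m + 1) ≤ 1 := Real.exp_le_one_iff.2 <| neg_nonpos.2 <|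
      Finset.sum_nonneg fun s _ => mul_nonneg (meanAt_nonneg f s) (by positivity)
    have e5 : (0 : ℝ) ≤ odds p ^ (m + 1) := by positivity
    change _ ≤ (1 - odds p ^ (m + 1)) * gapProb p f (m + 1)
    nlinarith
  rw [le_div_iff₀ h2]
  linarith

/-- Some site is almost surely not visited from its left, since `gapProb` at `m + 1` dominates the
`m`-th term of the series. -/
lemma transient_of_not_summable {p : unitInterval} (hp : (1 / 2 : ℝ) < p) (hp1 : (p : ℝ) < 1)
    {f : ℕ+ → ℝ≥0} (hf : Monotone f)
    (hs : ¬ Summable fun m : ℕ =>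
      Real.exp (-((1 - (p : ℝ)) / (2 * p - 1) * meanAt f (m + 1)))) : Transient p f := by
  have hs' : ¬ Summable fun m => gapProb p f (m + 1) := by
    intro h
    refine hs (Summable.of_nonneg_of_le (fun m => (Real.exp_pos _).le) (fun m => ?_)
      ((summable_nat_add_iff 1).2 h))
    exact Real.exp_le_exp.2 (neg_le_neg (meanVisits_le hp hp1 hf (m + 1)))
  have h1 := law_real_iUnion_allMiss hp hp1 hf hs'
  rw [measureReal_def, ENNReal.toReal_eq_one_iff] at h1
  have h2 := (mem_ae_iff_prob_eq_one
    (MeasurableSet.iUnion fun m => measurableSet_allMiss_ambient 0 (m + 1))).2 h1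
  refine measure_mono_null ?_ (ae_iff.1 (Filter.Eventually.and h2 (ae_steps p f)))
  intro ω hω hgood
  obtain ⟨m, hm⟩ := Set.mem_iUnion.1 hgood.1
  exact hω (finite_hitsOrigin hgood.2 (Nat.succ_pos m) hm)

/-! ### Recurrence -/

/-- If the frog that starts at the origin visits `N`, then it also visits `1, …, N - 1`, so that
none of these sites is missed. -/
lemma notMem_allMiss_of_visits {ω : Sample} (hstep : ∀ i k, ω.2 i k = -1 ∨ ω.2 i k = 1) {N m : ℕ}
    (hN : ω ∉ miss 0 N) (hm : 0 < m) (hmN : m ≤ N) : ω ∉ allMiss 0 m := by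
  intro h
  refine hN fun i hi hP hv => ?_
  obtain ⟨a, ha⟩ := hv
  have hlt : start i < m := by rw [hi]; exact_mod_cast hm
  have := position_lt (hstep i) hlt (a := a) fun b _ hb =>
    notMem_allMiss_iff.2 ⟨0, le_rfl, hm, i, hi, hP, b, hb⟩ h
  rw [position, hi, ha] at this
  push_cast at this
  omega

/-- With positive probability the frog that starts at the origin visits `1, …, N` and all further
sites are visited by other frogs from their left. -/
lemma not_transient_of_summable {p : unitInterval} (hp : (1 / 2 : ℝ) < p) (hp1 : (p : ℝ) < 1)
    {f : ℕ+ → ℝ≥0}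
    (hs : Summable fun m : ℕ =>
      Real.exp (-((1 - (p : ℝ)) / (2 * p - 1) * meanAt f (m + 1)))) : ¬ Transient p f := by
  intro htr
  have h0 := odds_pos hp hp1
  have hu := summable_gapProb hp hp1 hs
  obtain ⟨N, hN⟩ := ((tendsto_sum_nat_add fun m => gapProb p f (m + 1)).eventually
    (gt_mem_nhds one_pos)).exists
  let B : Set Sample := ⋃ k, allMiss 1 (k + N + 1)
  have hBm : MeasurableSet[sitesSigma (Set.Ici 1)] B :=
    @MeasurableSet.iUnion _ _ (_) _ _ fun k =>
      sitesSigma_mono Set.Ico_subset_Ici_self _ (measurableSet_allMiss 1 _)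
  have hB : (law p f).real B < 1 := by
    have h1 : law p f B ≤ ENNReal.ofReal (∑' k, gapProb p f (k + N + 1)) := by
      rw [ENNReal.ofReal_tsum_of_nonneg (fun k => (gapProb_pos p f _).le)
        ((summable_nat_add_iff (f := fun m => gapProb p f (m + 1)) N).2 hu)]
      refine (measure_iUnion_le _).trans (ENNReal.tsum_le_tsum fun k => ?_)
      rw [← ofReal_measureReal, law_real_allMiss hp hp1 f one_pos]
      rfl
    exact (ENNReal.toReal_le_of_le_ofReal
      (tsum_nonneg fun k => (gapProb_pos p f _).le) h1).trans_lt hN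
  have hpos : 0 < (law p f).real ((miss 0 N)ᶜ ∩ Bᶜ) := by
    rw [law_real_inter_of_disjoint p f (T := {0}) (T' := Set.Ici 1) (by simp)
      (@MeasurableSet.compl _ _ (_) (measurableSet_miss 0 N)) (@MeasurableSet.compl _ _ (_) hBm),
      probReal_compl_eq_one_sub (sitesSigma_le _ _ (measurableSet_miss 0 N)),
      probReal_compl_eq_one_sub (sitesSigma_le _ _ hBm), law_real_miss_zero hp hp1, sub_sub_cancel]
    exact mul_pos (pow_pos h0 N) (sub_pos.2 hB)
  have hbad : ∀ᵐ ω ∂(law p f), ω ∉ (miss 0 N)ᶜ ∩ Bᶜ := by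
    have htr' : ∀ᵐ ω ∂(law p f), ¬ {i | HitsOrigin ω i}.Infinite := by
      rw [ae_iff]
      simp only [not_not]
      exact htr
    filter_upwards [htr', ae_steps p f, ae_position_eq_zero hp hp1 f,
      ae_finite_visited hp hp1 f] with ω h1 h2 h3 h4 h5
    refine h1 (infinite_hitsOrigin (fun m hm => ?_) h3 h4)
    rcases le_or_gt m N with hmN | hmN
    · exact notMem_allMiss_of_visits h2 h5.1 hm hmN
    · intro hω
      obtain ⟨k, rfl⟩ : ∃ k, m = k + N + 1 := ⟨m - N - 1, by omega⟩
      exact h5.2 (Set.mem_iUnion.2 ⟨k, allMiss_subset zero_le_one hω⟩)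
  have hz : law p f ((miss 0 N)ᶜ ∩ Bᶜ) = 0 := by
    refine measure_mono_null (fun ω hω => ?_) (ae_iff.1 hbad)
    exact not_not_intro hω
  rw [measureReal_def, hz] at hpos
  simp at hpos

/-! ### The criterion -/

lemma tsum_eq_top_iff (c : ℝ) (f : ℕ+ → ℝ≥0) :
    ∑' j : ℕ+, ENNReal.ofReal (Real.exp (-(c * (f j : ℝ)))) = ∞ ↔
      ¬ Summable fun m : ℕ => Real.exp (-(c * meanAt f (m + 1))) := by
  have h := tsum_pnat_eq_tsum_succ (f := fun m => ENNReal.ofReal (Real.exp (-(c * meanAt f m))))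
  simp_rw [meanAt_coe] at h
  rw [h, iff_not_comm]
  constructor
  · exact Summable.tsum_ofReal_ne_top
  · intro hne
    simpa [ENNReal.toReal_ofReal (Real.exp_pos _).le] using ENNReal.summable_toReal hne

end FrogModel

theorem theorem2 (p : unitInterval) (hp : (1 / 2 : ℝ) < (p : ℝ)) (hp1 : (p : ℝ) < 1)
    (f : ℕ+ → ℝ≥0) (hf : Monotone f) :
    FrogModel.Transient p f ↔
      ∑' j : ℕ+, ENNReal.ofReal
        (Real.exp (-((1 - (p : ℝ)) / (2 * (p : ℝ) - 1) * (f j : ℝ)))) = ∞ := by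
  rw [FrogModel.tsum_eq_top_iff]
  exact ⟨fun ht hs => FrogModel.not_transient_of_summable hp hp1 hs ht,
    FrogModel.transient_of_not_summable hp hp1 hf⟩
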